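/- Let $\mathcal{C}$ be a Grothendieck category. For an object $X$ of $\mathcal{C}$, the dual Goldie dimension $\operatorname{codim}(X)\in\mathbb{N}\cup\{\infty\}$ is the Goldie dimension of the dual of the lattice of subobjects of $X$. Here the Goldie dimension of a modular lattice with least element $0$ is the supremum of the cardinalities of its finite join-independent sets of nonzero elements, where a finite set $S$ is join-independent if $a\wedge\bigvee (S\setminus\{a\})=0$ for every $a\in S$. The dual Goldie dimension of a module is defined in the same way from its lattice of submodules. A ring $R$ (associative, with identity) is semilocal if $R/J(R)$ is semisimple artinian, where $J(R)$ is its Jacobson radical; in that case $\operatorname{codim}(R_R)=\operatorname{codim}({}_RR)$, and this common value is denoted $\operatorname{codim}(R)$. Let $A$ be an object of $\mathcal{C}$ with a projective cover $\pi\colon P\to A$, that is, an epimorphism from a projective object $P$ whose kernel is superfluous (if $Y$ is a subobject of $P$ with $\ker\pi+Y=P$, then $Y=P$). Let $K$ be the kernel of $\pi$, and assume that $\operatorname{codim}(A)$ and $\operatorname{codim}(K)$ are finite. Then the ring $\operatorname{End}_{\mathcal{C}}(A)$ is semilocal, and $$\operatorname{codim}(\operatorname{End}_{\mathcal{C}}(A))\le\operatorname{codim}(A)+\operatorname{codim}(K).$$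 -/

import Mathlib

open CategoryTheory CategoryTheory.Limits

universe w v u

/-- The Goldie dimension of a (modular) lattice with least element: the supremum in `ℕ∞` of the
cardinalities of the finite join-independent sets of nonzero elements. (`Finset.SupIndep s id`
says that every `a ∈ s` is disjoint from the join of the other elements of `s`.) -/
noncomputable def latticeGoldieDim (L : Type*) [Lattice L] [OrderBot L] : ℕ∞ :=
  ⨆ (s : Finset L) (_ : ⊥ ∉ s) (_ : s.SupIndep id), (s.card : ℕ∞)

/-- The dual Goldie dimension `codim A` of an object `A` of an abelian category: the Goldie
dimension of the dual of the lattice of all subobjects of `A`. -/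
noncomputable def objCodim {C : Type*} [Category* C] [Abelian C] (A : C) : ℕ∞ :=
  latticeGoldieDim (Subobject A)ᵒᵈ

/-- The dual Goldie dimension of the regular right module `R_R`, whose lattice of submodules is the
lattice of right ideals of `R`. -/
noncomputable def rightRingCodim (R : Type*) [Ring R] : ℕ∞ :=
  latticeGoldieDim (Submodule Rᵐᵒᵖ R)ᵒᵈ

/-- The dual Goldie dimension of the regular left module `_R R`, whose lattice of submodules is the
lattice of left ideals of `R`. -/
noncomputable def leftRingCodim (R : Type*) [Ring R] : ℕ∞ :=
  latticeGoldieDim (Submodule R R)ᵒᵈ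

/-- A (not necessarily commutative) ring is semilocal if `R / J(R)` is semisimple artinian. -/
def IsSemilocal (R : Type*) [Ring R] : Prop :=
  IsSemisimpleRing (R ⧸ Ring.jacobson R)

/-- A subobject `X` of `A` is superfluous if `X + Y = A` implies `Y = A`, for all subobjects `Y`
of `A`. -/
def IsSuperfluous {C : Type*} [Category* C] [Abelian C] {A : C} (X : Subobject A) : Prop :=
  ∀ Y : Subobject A, X ⊔ Y = ⊤ → Y = ⊤

/-- A projective cover of `A` is an epimorphism `π : P ⟶ A` with `P` projective and with
superfluous kernel. -/
structure IsProjectiveCover {C : Type*} [Category* C] [Abelian C] {P A : C} (π : P ⟶ A) :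
    Prop where
  projective : Projective P
  epi : Epi π
  superfluous : IsSuperfluous (kernelSubobject π)

/-! An endomorphism `f` of `A` lifts along `π` to `P` by projectivity and then restricts to the
kernel `K`, so `End A` is a quotient of the endomorphism ring of the complex `K ⟶ P ⟶ A`. On that
ring put `d t = codim (A / im t₃) + codim (K / im t₁)`, which is at most `codim A + codim K`.

Modularity gives `d b + d (1 - ba) ≤ d (b - bab)`. If `d (1 - ba) = 0`, then `1 - ba` is epi on both
ends, and `IsProjectiveCover.isIso_of_epi_of_epi` makes it invertible on `A`; hence so is `1 - ab`.
So `d` grows strictly from `b` to `b - bab` unless `1 - ab` becomes a unit in `End A`. By the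
Camps–Dicks argument `leftRingCodim_le_of_rank`, the bound on `d` then bounds the size of every
coindependent set of left ideals. Passing to the opposite ring handles right ideals, and finite
codimension forces semilocality. -/

/-! ### Goldie dimension in modular lattices. -/

section Lattice

variable {L M : Type*} [Lattice L] [OrderBot L] [Lattice M] [OrderBot M]

/-- The Goldie dimension of the interval `[⊥, x]`, computed inside the ambient lattice. -/
noncomputable def goldieDimBelow (x : L) : ℕ∞ :=
  ⨆ (s : Finset L) (_ : (⊥ ∉ s ∧ s.SupIndep id) ∧ ∀ a ∈ s, a ≤ x), (s.card : ℕ∞)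

theorem card_le_goldieDimBelow {x : L} {s : Finset L} (h₀ : ⊥ ∉ s) (hs : s.SupIndep id)
    (hx : ∀ a ∈ s, a ≤ x) : (s.card : ℕ∞) ≤ goldieDimBelow x :=
  le_iSup₂_of_le s ⟨⟨h₀, hs⟩, hx⟩ le_rfl

theorem goldieDimBelow_le_latticeGoldieDim (x : L) : goldieDimBelow x ≤ latticeGoldieDim L :=
  iSup₂_le fun s hs => le_iSup_of_le s <| le_iSup₂_of_le hs.1.1 hs.1.2 le_rfl

theorem latticeGoldieDim_le_goldieDimBelow {x : L} (hx : ∀ a, a ≤ x) :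
    latticeGoldieDim L ≤ goldieDimBelow x :=
  iSup_le fun _ => iSup₂_le fun h₀ hs => card_le_goldieDimBelow h₀ hs fun a _ => hx a

theorem eq_bot_of_goldieDimBelow_eq_zero {x : L} (h : goldieDimBelow x = 0) : x = ⊥ := by
  by_contra hx
  have := card_le_goldieDimBelow (x := x) (s := {x}) (by simpa using Ne.symm hx)
    (Finset.supIndep_singleton x id) (by simp)
  simp [h] at this

/-- For `i ∈ s`, split the other elements into those in `s`, disjoint from `i` by independence, and
those in `t`, whose join is disjoint from everything below `s.sup id`. Modularity combines the two.
-/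
theorem Finset.SupIndep.union_of_disjoint_sup [IsModularLattice L] [DecidableEq L]
    {s t : Finset L} (hs : s.SupIndep id) (ht : t.SupIndep id)
    (h : Disjoint (s.sup id) (t.sup id)) : (s ∪ t).SupIndep id := by
  have key : ∀ {s t : Finset L}, s.SupIndep id → Disjoint (s.sup id) (t.sup id) →
      ∀ u ⊆ s ∪ t, ∀ i ∈ s, i ∉ u → Disjoint i (u.sup id) := by
    intro s t hs h u hu i hi hiu
    have h₁ : Disjoint i ((u ∩ s).sup id) :=
      hs Finset.inter_subset_right hi fun hmem => hiu (Finset.mem_inter.1 hmem).1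
    have h₂ : Disjoint (i ⊔ (u ∩ s).sup id) (t.sup id) :=
      h.mono_left (sup_le (Finset.le_sup (f := id) hi) (Finset.sup_mono Finset.inter_subset_right))
    refine (h₁.disjoint_sup_right_of_disjoint_sup_left h₂).mono_right (Finset.sup_le fun a ha => ?_)
    rcases Finset.mem_union.1 (hu ha) with has | hat
    · exact le_sup_of_le_left (Finset.le_sup (f := id) (Finset.mem_inter.2 ⟨ha, has⟩))
    · exact le_sup_of_le_right (Finset.le_sup (f := id) hat)
  intro u hu i hi hiu
  rcases Finset.mem_union.1 hi with hi | hi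
  · exact key hs h u hu i hi hiu
  · exact key ht h.symm u (by rwa [Finset.union_comm]) i hi hiu

theorem goldieDimBelow_add_le [IsModularLattice L] {x y z : L} (h : Disjoint x y)
    (hx : x ≤ z) (hy : y ≤ z) : goldieDimBelow x + goldieDimBelow y ≤ goldieDimBelow z := by
  classical
  refine ENat.biSup_add_biSup_le' ⟨∅, by simp⟩ ⟨∅, by simp⟩ fun s hs t ht => ?_
  have hst : Disjoint (s.sup id) (t.sup id) := h.mono (Finset.sup_le hs.2) (Finset.sup_le ht.2)
  -- A common element would lie below both `x` and `y`, hence be `⊥`.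
  have hdisj : Disjoint s t := Finset.disjoint_left.2 fun a has hat => hs.1.1 <| by
    rwa [← disjoint_self.1 (h.mono (hs.2 a has) (ht.2 a hat))]
  rw [← Nat.cast_add, ← Finset.card_union_of_disjoint hdisj]
  refine card_le_goldieDimBelow (by simp [hs.1.1, ht.1.1]) (hs.1.2.union_of_disjoint_sup ht.1.2 hst)
    fun a ha => ?_
  rcases Finset.mem_union.1 ha with ha | ha
  · exact (hs.2 a ha).trans hx
  · exact (ht.2 a ha).trans hy

theorem goldieDimBelow_le_of_map (g : L → M) (hbot : ∀ a, g a = ⊥ ↔ a = ⊥)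
    (hsup : ∀ a b, g (a ⊔ b) = g a ⊔ g b) (hdisj : ∀ a b, Disjoint a b → Disjoint (g a) (g b))
    {x : L} {y : M} (hxy : ∀ a ≤ x, g a ≤ y) : goldieDimBelow x ≤ goldieDimBelow y := by
  classical
  refine iSup₂_le fun s hs => ?_
  have hne : ∀ a ∈ s, g a ≠ ⊥ := fun a ha h => hs.1.1 ((hbot a).1 h ▸ ha)
  have hinj : Set.InjOn g s := fun a ha b hb hab => by
    by_contra hne'
    have h := hdisj _ _ (hs.1.2.pairwiseDisjoint ha hb hne')
    simp only [id, ← hab, disjoint_self] at h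
    exact hne a ha h
  rw [← Finset.card_image_of_injOn hinj]
  refine card_le_goldieDimBelow ?_ ?_ ?_
  · simpa using hne
  · refine Finset.SupIndep.image fun t ht i hi hit => ?_
    have hcomp : t.sup (id ∘ g) = g (t.sup id) :=
      (Finset.apply_sup_eq_sup_comp g hsup ((hbot ⊥).2 rfl)).symm
    rw [hcomp]
    exact hdisj _ _ (hs.1.2 ht hi hit)
  · simpa using fun a ha => hxy a (hs.2 a ha)

theorem OrderIso.latticeGoldieDim_le (e : L ≃o M) : latticeGoldieDim L ≤ latticeGoldieDim M := by
  refine iSup_le fun s => iSup₂_le fun h₀ hs => ?_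
  refine (card_le_goldieDimBelow (x := s.sup id) h₀ hs
    fun a ha => Finset.le_sup (f := id) ha).trans ?_
  exact (goldieDimBelow_le_of_map e (fun a => map_eq_bot_iff e) (map_sup e)
    (fun a b => (disjoint_map_orderIso_iff e).2) (fun a ha => e.monotone ha)).trans
    (goldieDimBelow_le_latticeGoldieDim _)

end Lattice

/-! ### The Camps–Dicks criterion and semilocal rings. -/

section Ring

theorem IsUnit.one_sub_mul_swap {R : Type*} [Ring R] {x y : R} (h : IsUnit (1 - x * y)) :
    IsUnit (1 - y * x) := by
  obtain ⟨v, hv₁, hv₂⟩ := isUnit_iff_exists.1 h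
  refine isUnit_iff_exists.2 ⟨1 + y * v * x, ?_, ?_⟩
  · have : (1 - y * x) * (1 + y * v * x) = 1 - y * x + y * ((1 - x * y) * v) * x := by noncomm_ring
    rw [this, hv₁, mul_one, sub_add_cancel]
  · have : (1 + y * v * x) * (1 - y * x) = 1 - y * x + y * (v * (1 - x * y)) * x := by noncomm_ring
    rw [this, hv₂, mul_one, sub_add_cancel]

/-- In the dual lattice, independence says that `I` is comaximal with the intersection of the other
ideals; `u` is the second component of `1`, as in the Chinese remainder theorem. -/
theorem exists_mem_ideals_of_supIndep {R : Type*} [Ring R] {s : Finset (Submodule R R)ᵒᵈ}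
    (hs : s.SupIndep id) {I : (Submodule R R)ᵒᵈ} (hI : I ∈ s) :
    ∃ u : R, 1 - u ∈ OrderDual.ofDual I ∧ ∀ J ∈ s, J ≠ I → u ∈ OrderDual.ofDual J := by
  classical
  have h := hs (s.erase_subset I) hI (s.notMem_erase I)
  have h' : OrderDual.ofDual I ⊔ OrderDual.ofDual ((s.erase I).sup id) = ⊤ :=
    codisjoint_iff.1 h
  obtain ⟨x, hx, u, hu, hxu⟩ := Submodule.mem_sup.1 (h' ▸ Submodule.mem_top (x := (1 : R)))
  refine ⟨u, by rwa [← hxu, add_sub_cancel_right], fun J hJ hne => ?_⟩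
  have hle : J ≤ (s.erase I).sup id := Finset.le_sup (f := id) (Finset.mem_erase.2 ⟨hne, hJ⟩)
  exact hle hu

/-- A Camps–Dicks criterion: a function on a ring `T` surjecting onto `R` which strictly increases
from `b` to `b - b * a * b` whenever `1 - a * b` does not become invertible in `R` bounds the dual
Goldie dimension of `R`. -/
theorem leftRingCodim_le_of_rank {T R : Type*} [Ring T] [Ring R] (φ : T →+* R)
    (hφ : Function.Surjective φ) (d : T → ℕ∞) {n : ℕ∞} (hn : ∀ b, d b ≤ n)
    (hd : ∀ a b, ¬ IsUnit (φ (1 - a * b)) → d b + 1 ≤ d (b - b * a * b)) :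
    leftRingCodim R ≤ n := by
  classical
  refine iSup_le fun s => iSup₂_le fun h₀ hs => ?_
  -- Ideals are absorbed one at a time: `b` vanishes modulo those in `t` and is `1` modulo the rest,
  -- and each step raises `d b` by at least one.
  have key : ∀ t ⊆ s, ∃ b : T, (∀ I ∈ t, φ b ∈ OrderDual.ofDual I) ∧
      (∀ I ∈ s, I ∉ t → 1 - φ b ∈ OrderDual.ofDual I) ∧ (t.card : ℕ∞) ≤ d b := by
    intro t
    induction t using Finset.induction_on with
    | empty => exact fun _ => ⟨1, by simp⟩
    | insert I t hIt ih =>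
      intro hts
      obtain ⟨b, hb₁, hb₂, hb₃⟩ := ih ((Finset.subset_insert I t).trans hts)
      have hI : I ∈ s := hts (Finset.mem_insert_self I t)
      obtain ⟨u, hu₁, hu₂⟩ := exists_mem_ideals_of_supIndep hs hI
      obtain ⟨a, rfl⟩ := hφ u
      have hIab : 1 - φ a * φ b ∈ OrderDual.ofDual I := by
        have : 1 - φ a * φ b = (1 - φ a) + φ a * (1 - φ b) := by noncomm_ring
        rw [this]
        exact add_mem hu₁ (Submodule.smul_mem _ (φ a) (hb₂ I hI hIt))
      -- The element lies in `I`, which is proper because `⊥` in the dual lattice is the whole ring.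
      have hunit : ¬ IsUnit (φ (1 - a * b)) := fun h => h₀ <| by
        have : OrderDual.ofDual I = ⊤ :=
          Ideal.eq_top_of_isUnit_mem (OrderDual.ofDual I) (by simpa using hIab) h
        have : I = ⊥ := this
        rwa [← this]
      refine ⟨b - b * a * b, fun J hJ => ?_, fun J hJ hJt => ?_, ?_⟩
      · rcases Finset.mem_insert.1 hJ with rfl | hJ
        · have : φ (b - b * a * b) = φ b * (1 - φ a * φ b) := by simp; noncomm_ring
          rw [this]
          exact Submodule.smul_mem _ (φ b) hIab
        · have : φ (b - b * a * b) = (1 - φ b * φ a) * φ b := by simp; noncomm_ring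
          rw [this]
          exact Submodule.smul_mem _ (1 - φ b * φ a) (hb₁ J hJ)
      · rw [Finset.mem_insert, not_or] at hJt
        have h₁ := hb₂ J hJ hJt.2
        have : 1 - φ (b - b * a * b) = (1 - φ b) + φ b * (φ a - φ a * (1 - φ b)) := by
          simp; noncomm_ring
        rw [this]
        exact add_mem h₁ (Submodule.smul_mem _ (φ b)
          (sub_mem (hu₂ J hJ hJt.1) (Submodule.smul_mem _ (φ a) h₁)))
      · rw [Finset.card_insert_of_notMem hIt, Nat.cast_add, Nat.cast_one]
        exact (add_le_add_left hb₃ 1).trans (hd a b hunit)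
  obtain ⟨b, -, -, hb⟩ := key s subset_rfl
  exact hb.trans (hn b)

theorem rightRingCodim_le_leftRingCodim_op (R : Type*) [Ring R] :
    rightRingCodim R ≤ leftRingCodim Rᵐᵒᵖ :=
  OrderIso.latticeGoldieDim_le (OrderIso.dual (Submodule.orderIsoMapComap
    ({ MulOpposite.opAddEquiv with map_smul' := fun _ _ => rfl } : R ≃ₗ[Rᵐᵒᵖ] Rᵐᵒᵖ)))

theorem rightRingCodim_le_of_rank {T R : Type*} [Ring T] [Ring R] (φ : T →+* R)
    (hφ : Function.Surjective φ) (d : T → ℕ∞) {n : ℕ∞} (hn : ∀ b, d b ≤ n)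
    (hd : ∀ a b, ¬ IsUnit (φ (1 - a * b)) → d b + 1 ≤ d (b - b * a * b)) :
    rightRingCodim R ≤ n := by
  refine (rightRingCodim_le_leftRingCodim_op R).trans
    (leftRingCodim_le_of_rank φ.op ?_ (fun b => d b.unop) (fun b => hn _) fun a b hab => ?_)
  · exact fun y => ⟨.op (hφ y.unop).choose, congrArg MulOpposite.op (hφ y.unop).choose_spec⟩
  -- The opposite ring exchanges `1 - ab` with `1 - ba`, which are units together, and leaves `b -
  -- bab` unchanged.
  · have := hd a.unop b.unop fun h => hab ?_
    · simpa [mul_assoc] using this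
    · have h' : IsUnit (1 - φ a.unop * φ b.unop) := by simpa using h
      simpa using h'.one_sub_mul_swap.op

/-- If the finite coindependent sets of left ideals of `R` have bounded cardinality, then some
finite set of maximal left ideals has intersection `J(R)`. -/
theorem exists_finset_isCoatom_inf_le_jacobson {R : Type*} [Ring R] (h : leftRingCodim R ≠ ⊤) :
    ∃ s : Finset (Submodule R R), (∀ m ∈ s, IsCoatom m) ∧ s.inf id ≤ Ring.jacobson R := by
  classical
  obtain ⟨n, hn⟩ := ENat.ne_top_iff_exists.1 h
  let p : ℕ → Prop := fun k => ∃ s : Finset (Submodule R R)ᵒᵈ,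
    (∀ m ∈ s, IsAtom m) ∧ s.SupIndep id ∧ s.card = k
  have hbound : ∀ k, p k → k ≤ n := by
    rintro k ⟨s, hs, hind, rfl⟩
    have : (s.card : ℕ∞) ≤ leftRingCodim R :=
      le_iSup_of_le s (le_iSup₂_of_le (fun hb => (hs _ hb).1 rfl) hind le_rfl)
    rw [← hn] at this
    exact_mod_cast this
  have hp0 : p 0 := ⟨∅, by simp, Finset.supIndep_empty _, rfl⟩
  -- Take a coindependent set of maximal left ideals of largest size: a maximal left ideal not
  -- containing its intersection could be adjoined.
  obtain ⟨s, hs, hind, hcard⟩ := Nat.findGreatest_spec (P := p) (Nat.zero_le n) hp0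
  refine ⟨s.map OrderDual.ofDual.toEmbedding, ?_, ?_⟩
  · intro m hm
    obtain ⟨m', hm', rfl⟩ := Finset.mem_map.1 hm
    exact isAtom_dual_iff_isCoatom.1 (hs m' hm')
  · have hsup : (s.map OrderDual.ofDual.toEmbedding).inf id = OrderDual.ofDual (s.sup id) := by
      rw [Finset.inf_map]; rfl
    rw [hsup]
    refine le_sInf fun m hm => ?_
    by_contra hle
    have hatom : IsAtom (OrderDual.toDual m) := isAtom_dual_iff_isCoatom.2 hm
    have hdisj : Disjoint (OrderDual.toDual m) (s.sup id) := hatom.not_le_iff_disjoint.1 hle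
    have hms : OrderDual.toDual m ∉ s := fun hmem => hle (Finset.le_sup (f := id) hmem)
    have hins : p (Nat.findGreatest p n + 1) := by
      refine ⟨insert (OrderDual.toDual m) s, ?_, ?_, by rw [Finset.card_insert_of_notMem hms, hcard]⟩
      · intro a ha
        rcases Finset.mem_insert.1 ha with rfl | ha
        exacts [hatom, hs a ha]
      · rw [Finset.insert_eq]
        exact (Finset.supIndep_singleton _ _).union_of_disjoint_sup hind (by simpa using hdisj)
    have := Nat.le_findGreatest (hbound _ hins) hins
    omega

theorem isSemilocal_of_leftRingCodim_ne_top {R : Type*} [Ring R] (h : leftRingCodim R ≠ ⊤) :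
    IsSemilocal R := by
  obtain ⟨s, hs, hinf⟩ := exists_finset_isCoatom_inf_le_jacobson h
  have hss : IsSemisimpleModule R (R ⧸ Ring.jacobson R) := by
    have hsimple : ∀ m : s, IsSimpleModule R (R ⧸ (m : Submodule R R)) :=
      fun m => isSimpleModule_iff_isCoatom.2 (hs m m.2)
    let f : R →ₗ[R] (∀ m : s, R ⧸ (m : Submodule R R)) :=
      LinearMap.pi fun m => (m : Submodule R R).mkQ
    have hker : LinearMap.ker f ≤ Ring.jacobson R := fun x hx => hinf <| by
      rw [Submodule.mem_finsetInf]
      intro m hm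
      have := congrFun (LinearMap.mem_ker.1 hx) ⟨m, hm⟩
      exact (Submodule.Quotient.mk_eq_zero m).1 this
    have : IsSemisimpleModule R (R ⧸ LinearMap.ker f) :=
      .of_injective ((LinearMap.ker f).liftQ f le_rfl)
        (LinearMap.ker_eq_bot.1 (Submodule.ker_liftQ_eq_bot _ _ _ le_rfl))
    exact IsSemisimpleModule.of_surjective (Submodule.factor hker) (Submodule.factor_surjective hker)
  -- The identity, semilinear over `R → R / J(R)`, carries semisimplicity over `R` to semisimplicity
  -- over `R / J(R)`.
  have hbij : Function.Bijective ({ AddMonoidHom.id (R ⧸ Ring.jacobson R) with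
      map_smul' := fun r x => by
        induction x using Submodule.Quotient.induction_on with
        | _ x => rfl } :
      (R ⧸ Ring.jacobson R) →ₛₗ[Ideal.Quotient.mk (Ring.jacobson R)] (R ⧸ Ring.jacobson R)) :=
    Function.bijective_id
  have : RingHomSurjective (Ideal.Quotient.mk (Ring.jacobson R)) := ⟨Ideal.Quotient.mk_surjective⟩
  exact (LinearMap.isSemisimpleModule_iff_of_bijective _ hbij).1 hss

end Ring

/-! ### Subobject lattices in abelian categories. -/

section Subobject

variable {C : Type u} [Category.{v} C] [Abelian C]

theorem CategoryTheory.Subobject.factors_of_epi_comp {X Y Z : C} {U : Subobject Z} (e : X ⟶ Y)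
    [Epi e] {g : Y ⟶ Z} (h : U.Factors (e ≫ g)) : U.Factors g := by
  have hzero : g ≫ cokernel.π U.arrow = 0 := by
    rw [← cancel_epi e, ← Category.assoc, ← U.factorThru_arrow _ h, Category.assoc,
      cokernel.condition, comp_zero, comp_zero]
  have := U.factors_comp_arrow (Abelian.monoLift U.arrow g hzero)
  rwa [Abelian.monoLift_comp] at this

theorem CategoryTheory.Subobject.eq_top_of_epi_of_factors {X Y : C} {U : Subobject Y} (p : X ⟶ Y)
    [Epi p] (h : U.Factors p) : U = ⊤ := by
  have : U.Factors (𝟙 Y) := Subobject.factors_of_epi_comp p (by rwa [Category.comp_id])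
  refine top_le_iff.1 (Subobject.le_of_factors ?_)
  have := Subobject.factors_of_factors_right (⊤ : Subobject Y).arrow this
  rwa [Category.comp_id] at this

/-- Generalized elements of a sum decompose after an epi refinement, because `U ⊞ V` maps onto the
image of `biprod.desc`. This permits element-style arguments such as the proof of modularity. -/
theorem CategoryTheory.Subobject.factors_sup_iff {X Z : C} {U V : Subobject Z} {g : X ⟶ Z} :
    (U ⊔ V).Factors g ↔ ∃ (X' : C) (e : X' ⟶ X) (_ : Epi e) (g₁ g₂ : X' ⟶ Z),
      U.Factors g₁ ∧ V.Factors g₂ ∧ e ≫ g = g₁ + g₂ := by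
  constructor
  · intro h
    let q : (U : C) ⊞ (V : C) ⟶ Z := biprod.desc U.arrow V.arrow
    have hU : U ≤ imageSubobject q := Subobject.le_of_factors <| by
      simpa [q] using imageSubobject_factors_comp_self q biprod.inl
    have hV : V ≤ imageSubobject q := Subobject.le_of_factors <| by
      simpa [q] using imageSubobject_factors_comp_self q biprod.inr
    have hg := Subobject.factors_of_le g (sup_le hU hV) h
    obtain ⟨X', e, he, y, hy⟩ := surjective_up_to_refinements_of_epi
      (factorThruImageSubobject q) ((imageSubobject q).factorThru g hg)
    refine ⟨X', e, he, (y ≫ biprod.fst) ≫ U.arrow, (y ≫ biprod.snd) ≫ V.arrow,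
      U.factors_comp_arrow _, V.factors_comp_arrow _, ?_⟩
    have := congrArg (· ≫ (imageSubobject q).arrow) hy
    simp only [Category.assoc, Subobject.factorThru_arrow, imageSubobject_arrow_comp] at this
    simp [this, q, biprod.desc_eq]
  · rintro ⟨X', e, he, g₁, g₂, h₁, h₂, h⟩
    refine Subobject.factors_of_epi_comp e ?_
    rw [h]
    exact Subobject.factors_add _ _ (Subobject.sup_factors_of_factors_left h₁)
      (Subobject.sup_factors_of_factors_right h₂)

instance CategoryTheory.Subobject.isModularLattice (X : C) : IsModularLattice (Subobject X) where
  sup_inf_le_assoc_of_le {U} V {W} hUW := by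
    refine Subobject.le_of_factors ?_
    obtain ⟨hsup, hW⟩ := (Subobject.inf_factors _).1 (Subobject.factors_self ((U ⊔ V) ⊓ W))
    obtain ⟨X', e, he, g₁, g₂, h₁, h₂, h⟩ := Subobject.factors_sup_iff.1 hsup
    refine Subobject.factors_sup_iff.2 ⟨X', e, he, g₁, g₂, h₁, (Subobject.inf_factors _).2
      ⟨h₂, ?_⟩, h⟩
    exact Subobject.factors_right_of_factors_add g₁ g₂
      (h ▸ Subobject.factors_of_factors_right e hW) (Subobject.factors_of_le _ hUW h₁)

theorem CategoryTheory.Subobject.sup_eq_top_of_factors {X Y : C} {U V : Subobject Y} (p : X ⟶ Y)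
    [Epi p] {p₁ p₂ : X ⟶ Y} (h : p = p₁ + p₂) (h₁ : U.Factors p₁) (h₂ : V.Factors p₂) :
    U ⊔ V = ⊤ :=
  Subobject.eq_top_of_epi_of_factors p <| h ▸ Subobject.factors_add _ _
    (Subobject.sup_factors_of_factors_left h₁) (Subobject.sup_factors_of_factors_right h₂)

theorem imageSubobject_eq_top_iff {X Y : C} (f : X ⟶ Y) : imageSubobject f = ⊤ ↔ Epi f := by
  constructor
  · intro h
    have : IsIso (imageSubobject f).arrow := (Subobject.isIso_arrow_iff_eq_top _).2 h
    rw [← imageSubobject_arrow_comp f]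
    exact epi_comp _ _
  · intro _
    refine Subobject.eq_top_of_epi_of_factors f ?_
    simpa using imageSubobject_factors_comp_self f (𝟙 X)

theorem CategoryTheory.Subobject.pullback_obj_factors_iff {X Y Z : C} (f : X ⟶ Y)
    (U : Subobject Y) (g : Z ⟶ X) : ((Subobject.pullback f).obj U).Factors g ↔ U.Factors (g ≫ f) := by
  have hp := Subobject.isPullback f U
  constructor
  · intro h
    rw [← Subobject.factorThru_arrow _ g h, Category.assoc, ← hp.w, ← Category.assoc]
    exact U.factors_comp_arrow _
  · intro h
    have := ((Subobject.pullback f).obj U).factors_comp_arrow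
      (hp.lift (U.factorThru _ h) g (by simp))
    rwa [hp.lift_snd] at this

theorem CategoryTheory.Subobject.pullback_obj_eq_top_iff {X Y : C} (f : X ⟶ Y) [Epi f]
    (U : Subobject Y) : (Subobject.pullback f).obj U = ⊤ ↔ U = ⊤ := by
  refine ⟨fun h => ?_, fun h => by rw [h, Subobject.pullback_top]⟩
  have : ((Subobject.pullback f).obj U).Factors (𝟙 X) := h ▸ Subobject.top_factors _
  rw [Subobject.pullback_obj_factors_iff, Category.id_comp] at this
  exact Subobject.eq_top_of_epi_of_factors f this

theorem CategoryTheory.Subobject.pullback_obj_sup_eq_top {X Y : C} (f : X ⟶ Y) [Epi f]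
    {U V : Subobject Y} (h : U ⊔ V = ⊤) :
    (Subobject.pullback f).obj U ⊔ (Subobject.pullback f).obj V = ⊤ := by
  obtain ⟨X', e, he, g₁, g₂, h₁, h₂, hg⟩ :=
    Subobject.factors_sup_iff.1 (h ▸ Subobject.top_factors f : (U ⊔ V).Factors f)
  obtain ⟨X'', e', he', y, hy⟩ := surjective_up_to_refinements_of_epi f g₁
  -- `y` lifts the `U`-component of `f`, so the remainder `e' ≫ e - y` maps to the `V`-component.
  refine Subobject.sup_eq_top_of_factors (e' ≫ e) (p₁ := y) (p₂ := e' ≫ e - y) (by simp) ?_ ?_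
  · rw [Subobject.pullback_obj_factors_iff, ← hy]
    exact Subobject.factors_of_factors_right _ h₁
  · rw [Subobject.pullback_obj_factors_iff, Preadditive.sub_comp, Category.assoc, hg, ← hy,
      Preadditive.comp_add, add_sub_cancel_left]
    exact Subobject.factors_of_factors_right _ h₂

/-- The dual Goldie dimension of the interval `[U, ⊤]` of subobjects of `X`, that is, of the
quotient `X / U`. -/
noncomputable def codimAbove {X : C} (U : Subobject X) : ℕ∞ :=
  goldieDimBelow (OrderDual.toDual U)

theorem codimAbove_le_objCodim {X : C} (U : Subobject X) : codimAbove U ≤ objCodim X :=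
  goldieDimBelow_le_latticeGoldieDim _

theorem codimAbove_add_le {X : C} {U V W : Subobject X} (h : U ⊔ V = ⊤) (hU : W ≤ U) (hV : W ≤ V) :
    codimAbove U + codimAbove V ≤ codimAbove W :=
  goldieDimBelow_add_le (L := (Subobject X)ᵒᵈ) (codisjoint_iff.2 h) hU hV

theorem eq_top_of_codimAbove_eq_zero {X : C} {U : Subobject X} (h : codimAbove U = 0) : U = ⊤ :=
  eq_bot_of_goldieDimBelow_eq_zero (L := (Subobject X)ᵒᵈ) h

/-- Pulling back along `f` carries coindependent families in `Y` to coindependent families above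
`ker f`, hence above `U`. -/
theorem objCodim_le_codimAbove_of_comp_eq_zero {X Y : C} (f : X ⟶ Y) [Epi f] {U : Subobject X}
    (hU : U.arrow ≫ f = 0) : objCodim Y ≤ codimAbove U := by
  refine (latticeGoldieDim_le_goldieDimBelow (L := (Subobject Y)ᵒᵈ)
    (x := OrderDual.toDual ⊥) fun V => bot_le (α := Subobject Y)).trans ?_
  refine goldieDimBelow_le_of_map (L := (Subobject Y)ᵒᵈ) (M := (Subobject X)ᵒᵈ)
    (fun V => OrderDual.toDual ((Subobject.pullback f).obj (OrderDual.ofDual V)))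
    (fun V => Subobject.pullback_obj_eq_top_iff f (OrderDual.ofDual V))
    (fun V W => Subobject.inf_pullback f (OrderDual.ofDual V) (OrderDual.ofDual W))
    (fun V W h => codisjoint_iff.2
      (Subobject.pullback_obj_sup_eq_top f (codisjoint_iff.1 h)))
    fun V _ => ?_
  refine Subobject.le_of_factors (P := U) ?_
  refine (Subobject.pullback_obj_factors_iff f (OrderDual.ofDual V) U.arrow).2 ?_
  rw [hU]
  exact Subobject.factors_zero

/-- The superadditivity behind the Camps–Dicks criterion: `im (b - bab)` is contained in `im b` and
in `im (1 - ba)`, whose sum is everything. -/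
theorem codimAbove_image_add_le {X : C} (a b : End X) :
    codimAbove (imageSubobject b) + codimAbove (imageSubobject (1 - b * a : End X)) ≤
      codimAbove (imageSubobject (b - b * a * b : End X)) := by
  refine codimAbove_add_le ?_ ?_ ?_
  · refine Subobject.sup_eq_top_of_factors (𝟙 X) (p₁ := a ≫ b) (p₂ := (1 - b * a : End X)) ?_
      (imageSubobject_factors_comp_self b a) ?_
    · simp [End.mul_def, End.one_def]
    · simpa using imageSubobject_factors_comp_self (1 - b * a : End X) (𝟙 X)
  · have : (b - b * a * b : End X) = b * (1 - a * b) := by noncomm_ring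
    rw [this]
    exact imageSubobject_comp_le _ _
  · have : (b - b * a * b : End X) = (1 - b * a) * b := by noncomm_ring
    rw [this]
    exact imageSubobject_comp_le _ _

/-- If `s ≫ π` is epi then `ker π + im s = P`, and `ker π` is superfluous. -/
theorem IsProjectiveCover.epi_of_epi_comp {P A X : C} {π : P ⟶ A} (hπ : IsProjectiveCover π)
    (s : X ⟶ P) [Epi (s ≫ π)] : Epi s := by
  have := hπ.epi
  rw [← imageSubobject_eq_top_iff]
  refine hπ.superfluous _ ?_
  obtain ⟨X', e, he, y, hy⟩ := surjective_up_to_refinements_of_epi (s ≫ π) π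
  refine Subobject.sup_eq_top_of_factors e (p₁ := e - y ≫ s) (p₂ := y ≫ s) (by simp) ?_
    (imageSubobject_factors_comp_self s y)
  rw [kernelSubobject_factors_iff]
  simp [hy]

end Subobject

/-! ### Endomorphisms of a projective cover. -/

section ProjectiveCover

variable {C : Type u} [Category.{v} C] [Abelian C]

/-- The short complex `kernel π ⟶ P ⟶ A` attached to `π : P ⟶ A`. -/
noncomputable abbrev kernelComplex {P A : C} (π : P ⟶ A) : ShortComplex C :=
  ShortComplex.mk (kernel.ι π) π (kernel.condition π)

theorem kernelComplex_exact {P A : C} (π : P ⟶ A) : (kernelComplex π).Exact :=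
  ShortComplex.exact_kernel π

/-- The action of the endomorphisms of a short complex on its third object. -/
def CategoryTheory.ShortComplex.endThird (S : ShortComplex C) : End S →+* End S.X₃ where
  toFun t := t.τ₃
  map_one' := rfl
  map_mul' _ _ := rfl
  map_zero' := rfl
  map_add' _ _ := rfl

theorem IsProjectiveCover.endThird_surjective {P A : C} {π : P ⟶ A} (hπ : IsProjectiveCover π) :
    Function.Surjective (ShortComplex.endThird (kernelComplex π)) := by
  intro f
  have := hπ.projective
  have := hπ.epi
  let g : P ⟶ P := Projective.factorThru (π ≫ (f : A ⟶ A)) π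
  have hg : g ≫ π = π ≫ (f : A ⟶ A) := Projective.factorThru_comp _ _
  let h : kernel π ⟶ kernel π := kernel.lift π (kernel.ι π ≫ g) (by simp [hg])
  exact ⟨ShortComplex.homMk h g f (kernel.lift_ι _ _ _) hg, rfl⟩

/-- If `A` has finite dual Goldie dimension, then an endomorphism of `kernel π ⟶ P ⟶ A` that is
epi on both ends is invertible on `A`. -/
theorem IsProjectiveCover.isIso_of_epi_of_epi {P A : C} {π : P ⟶ A} (hπ : IsProjectiveCover π)
    (hA : objCodim A ≠ ⊤) (t : kernelComplex π ⟶ kernelComplex π) (h₁ : Epi t.τ₁)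
    (h₃ : Epi t.τ₃) : IsIso t.τ₃ := by
  have := hπ.projective
  have := hπ.epi
  have h₂ : Epi t.τ₂ := ShortComplex.epi_of_epi_of_epi_of_epi t (kernelComplex_exact π) hπ.epi h₁ h₃
  -- The epi `t.τ₂` splits since `P` is projective; it remains to show that its section `s` is epi.
  let s : P ⟶ P := Projective.factorThru (𝟙 P) t.τ₂
  have hs : s ≫ t.τ₂ = 𝟙 P := Projective.factorThru_comp _ _
  have hcomm : t.τ₂ ≫ π = π ≫ t.τ₃ := t.comm₂₃
  have hsup : imageSubobject (s ≫ π) ⊔ kernelSubobject t.τ₃ = ⊤ := by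
    refine Subobject.sup_eq_top_of_factors π (p₁ := t.τ₂ ≫ s ≫ π) (p₂ := π - t.τ₂ ≫ s ≫ π)
      (by simp) (imageSubobject_factors_comp_self _ _) ((kernelSubobject_factors_iff _ _).2 ?_)
    rw [Preadditive.sub_comp, Category.assoc, Category.assoc, ← hcomm, reassoc_of% hs, hcomm,
      sub_self]
  -- Since `t.τ₃` is epi, `A / ker t.τ₃` already has codimension at least that of `A`; cancelling
  -- the finite `objCodim A` leaves nothing for `A / im (s ≫ π)`.
  have hadd : codimAbove (imageSubobject (s ≫ π)) + objCodim A ≤ 0 + objCodim A := by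
    rw [zero_add]
    exact (add_le_add_right (objCodim_le_codimAbove_of_comp_eq_zero t.τ₃
      (kernelSubobject_arrow_comp t.τ₃)) _).trans
      ((codimAbove_add_le hsup bot_le bot_le).trans (codimAbove_le_objCodim ⊥))
  have hzero : codimAbove (imageSubobject (s ≫ π)) = 0 :=
    nonpos_iff_eq_zero.1 ((ENat.add_le_add_iff_right hA).1 hadd)
  have : Epi (s ≫ π) := (imageSubobject_eq_top_iff _).1 (eq_top_of_codimAbove_eq_zero hzero)
  have : Epi s := hπ.epi_of_epi_comp s
  have : Mono s := mono_of_mono_fac hs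
  have : IsIso s := isIso_of_mono_of_epi s
  have : IsIso t.τ₂ := (IsIso.inv_eq_of_hom_inv_id hs) ▸ inferInstance
  -- Four lemma: `t.τ₁` epi and `t.τ₂` mono force `t.τ₃` to be mono.
  have : Mono t.τ₃ := ShortComplex.mono_of_epi_of_epi_of_mono t (kernelComplex_exact π) hπ.epi h₁
    inferInstance
  exact isIso_of_mono_of_epi _

/-- The sum of the dual Goldie dimensions of the cokernels of the actions of an endomorphism of a
short complex on its two ends. -/
noncomputable def cokernelCodim (S : ShortComplex C) (t : End S) : ℕ∞ :=
  codimAbove (imageSubobject t.τ₃) + codimAbove (imageSubobject t.τ₁)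

theorem cokernelCodim_add_le {S : ShortComplex C} (a b : End S) :
    cokernelCodim S b + cokernelCodim S (1 - b * a) ≤ cokernelCodim S (b - b * a * b) := by
  refine le_of_eq_of_le (add_add_add_comm _ _ _ _) (add_le_add ?_ ?_)
  · exact codimAbove_image_add_le (X := S.X₃) a.τ₃ b.τ₃
  · exact codimAbove_image_add_le (X := S.X₁) a.τ₁ b.τ₁

theorem IsProjectiveCover.isUnit_of_cokernelCodim_eq_zero {P A : C} {π : P ⟶ A}
    (hπ : IsProjectiveCover π) (hA : objCodim A ≠ ⊤) (t : End (kernelComplex π))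
    (ht : cokernelCodim _ t = 0) : IsUnit (ShortComplex.endThird _ t) := by
  obtain ⟨h₃, h₁⟩ := add_eq_zero.1 ht
  exact (isUnit_iff_isIso _).2 (hπ.isIso_of_epi_of_epi hA t
    ((imageSubobject_eq_top_iff _).1 (eq_top_of_codimAbove_eq_zero h₁))
    ((imageSubobject_eq_top_iff _).1 (eq_top_of_codimAbove_eq_zero h₃)))

theorem IsProjectiveCover.cokernelCodim_add_one_le {P A : C} {π : P ⟶ A}
    (hπ : IsProjectiveCover π) (hA : objCodim A ≠ ⊤) (a b : End (kernelComplex π))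
    (h : ¬ IsUnit (ShortComplex.endThird _ (1 - a * b))) :
    cokernelCodim _ b + 1 ≤ cokernelCodim _ (b - b * a * b) := by
  refine le_trans ?_ (cokernelCodim_add_le a b)
  have hne : cokernelCodim _ (1 - b * a) ≠ 0 := fun h₀ => h <| by
    have := hπ.isUnit_of_cokernelCodim_eq_zero hA _ h₀
    rw [map_sub, map_one, map_mul] at this ⊢
    exact this.one_sub_mul_swap
  gcongr
  exact Order.one_le_iff_pos.2 (pos_iff_ne_zero.2 hne)

theorem cokernelCodim_le {S : ShortComplex C} (t : End S) :
    cokernelCodim S t ≤ objCodim S.X₃ + objCodim S.X₁ :=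
  add_le_add (codimAbove_le_objCodim _) (codimAbove_le_objCodim _)

end ProjectiveCover

theorem theorem7p3 {C : Type u} [Category.{v} C] [Abelian C]
    [IsGrothendieckAbelian.{w} C] {A P : C} (π : P ⟶ A) (hπ : IsProjectiveCover π)
    (hA : objCodim A ≠ ⊤) (hK : objCodim (kernel π) ≠ ⊤) :
    IsSemilocal (End A) ∧
      rightRingCodim (End A) ≤ objCodim A + objCodim (kernel π) ∧
      leftRingCodim (End A) ≤ objCodim A + objCodim (kernel π) := by
  have hleft : leftRingCodim (End A) ≤ objCodim A + objCodim (kernel π) :=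
    leftRingCodim_le_of_rank _ hπ.endThird_surjective _ cokernelCodim_le
      (hπ.cokernelCodim_add_one_le hA)
  have hright : rightRingCodim (End A) ≤ objCodim A + objCodim (kernel π) :=
    rightRingCodim_le_of_rank _ hπ.endThird_surjective _ cokernelCodim_le
      (hπ.cokernelCodim_add_one_le hA)
  exact ⟨isSemilocal_of_leftRingCodim_ne_top
    (ne_top_of_le_ne_top (WithTop.add_ne_top.2 ⟨hA, hK⟩) hleft), hright, hleft⟩
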